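/- Theorem (Lagrange identity for Hamiltonian nabla systems). Let $\mathbb{T}\subseteq\mathbb{R}$ be a time scale (a nonempty closed set), let $a\le b$ be points of $\mathbb{T}$, and let $\rho(t)=\sup\{s\in\mathbb{T}: s<t\}$ (with $\rho(t)=t$ if this set is empty) be the backward jump operator. Write $[c,d]_{\mathbb{T}}=\mathbb{T}\cap[c,d]$, $f^\rho=f\circ\rho$, and let $M^*$ denote the conjugate transpose of $M$. Let $\mathcal{A},\mathcal{B},\mathcal{C}$ be $d\times d$ complex matrix-valued functions such that $\mathcal{B}(t)$ and $\mathcal{C}(t)$ are Hermitian for $t\in[a,b]_{\mathbb{T}}$; no continuity of the coefficients is required. Put $$ H(t)=\begin{pmatrix} -\mathcal{C}(t) & \mathcal{A}^*(t)\\ \mathcal{A}(t) & \mathcal{B}(t)\end{pmatrix},\qquad J=\begin{pmatrix}0&-I\\ I&0\end{pmatrix}, $$ and, for functions $x,u:[\rho(a),b]_{\mathbb{T}}\to\mathbb{C}^d$ that are nabla differentiable at every point of $[a,b]_{\mathbb{T}}$ (as functions on $[\rho(a),b]_{\mathbb{T}}$), put $$ \ell(x,u)(t)=J\begin{pmatrix}x^\nabla(t)\\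 u^\nabla(t)\end{pmatrix}-H(t)\begin{pmatrix}x(t)\\ u^\rho(t)\end{pmatrix},\qquad t\in[a,b]_{\mathbb{T}}. $$ Let $(x,u)$ and $(y,v)$ be two such pairs. Then $$ \int_{\rho(a)}^{b}\left\{\left(y^*,v^{\rho*}\right)\ell(x,u)-\ell(y,v)^*\begin{pmatrix}x\\ u^\rho\end{pmatrix}\right\}(t)\,\nabla t=\left(y^*(t),v^*(t)\right)J\begin{pmatrix}x(t)\\ u(t)\end{pmatrix}\Big|_{t=\rho(a)}^{t=b} $$ whenever the (Lebesgue) nabla integral on the left-hand side exists, that is, whenever its integrand is nabla integrable over $(\rho(a),b]_{\mathbb{T}}$. This is the case in particular if $x^\nabla,u^\nabla,y^\nabla,v^\nabla$ are left-dense continuous on $[a,b]_{\mathbb{T}}$. -/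

import Mathlib

open Set Filter Topology MeasureTheory
open scoped Matrix

noncomputable section

namespace TimeScale

/-- A time scale is a nonempty closed subset of the real line. -/
def IsTimeScale (T : Set ℝ) : Prop := T.Nonempty ∧ IsClosed T

/-- The interval `[c, d]_T` of a time scale. -/
def tsIcc (T : Set ℝ) (c d : ℝ) : Set ℝ := T ∩ Icc c d

open Classical in
/-- The backward jump operator `ρ(t) = sup {s ∈ T | s < t}`, with `ρ(t) = t` if there is no point
of `T` to the left of `t`. -/
def rho (T : Set ℝ) (t : ℝ) : ℝ := if (T ∩ Iio t).Nonempty then sSup (T ∩ Iio t) else t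

open Classical in
/-- The forward jump operator `σ(t) = inf {s ∈ T | t < s}`, with `σ(t) = t` if there is no point
of `T` to the right of `t`. -/
def sigma (T : Set ℝ) (t : ℝ) : ℝ := if (T ∩ Ioi t).Nonempty then sInf (T ∩ Ioi t) else t

/-- `t` is left-dense: `t` is not the smallest point and `ρ(t) = t`. -/
def LeftDense (T : Set ℝ) (t : ℝ) : Prop := (T ∩ Iio t).Nonempty ∧ rho T t = t

/-- `t` is right-dense: `t` is not the largest point and `σ(t) = t`. -/
def RightDense (T : Set ℝ) (t : ℝ) : Prop := (T ∩ Ioi t).Nonempty ∧ sigma T t = t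

section Derivative

variable {E : Type*} [NormedAddCommGroup E] [NormedSpace ℝ E]

/-- A function `f` given on the subset `D` of the time scale `T` has nabla derivative `f'` at `t`:
for every `ε > 0` one has `‖f(ρ(t)) - f(s) - (ρ(t) - s) f'‖ ≤ ε |ρ(t) - s|`
for all `s ∈ D` sufficiently close to `t`. -/
def HasNablaDerivWithinAt (T D : Set ℝ) (f : ℝ → E) (f' : E) (t : ℝ) : Prop :=
  ∀ ε > 0, ∃ δ > 0, ∀ s ∈ D, |s - t| < δ →
    ‖f (rho T t) - f s - (rho T t - s) • f'‖ ≤ ε * |rho T t - s|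

/-- Nabla differentiability at `t` of a function given on `D ⊆ T`. -/
def NablaDifferentiableWithinAt (T D : Set ℝ) (f : ℝ → E) (t : ℝ) : Prop :=
  ∃ f' : E, HasNablaDerivWithinAt T D f f' t

open Classical in
/-- The nabla derivative `f^∇(t)` of a function given on `D ⊆ T` (zero where there is none). -/
def nablaDerivWithin (T D : Set ℝ) (f : ℝ → E) (t : ℝ) : E :=
  if h : NablaDifferentiableWithinAt T D f t then h.choose else 0

/-- `f` is left-dense continuous on the time scale `S`: it is continuous at the left-dense points
of `S` and has (finite) right-sided limits at the right-dense points of `S`. -/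
def LdContinuousOn (S : Set ℝ) (f : ℝ → E) : Prop :=
  ∀ t ∈ S, (LeftDense S t → ContinuousWithinAt f S t) ∧
    (RightDense S t → ∃ l : E, Tendsto f (𝓝[S ∩ Ioi t] t) (𝓝 l))

end Derivative

/-- The Lebesgue nabla measure of the time scale `T`: Lebesgue measure on `T` plus a point mass
`t - ρ(t)` at every left-scattered point `t` of `T`. It is carried by `T` and gives `(c, d]` the
mass `d - c` for all points `c ≤ d` of `T`. -/
def nablaMeasure (T : Set ℝ) : Measure ℝ :=
  volume.restrict T +
    Measure.sum fun t : {t : ℝ // t ∈ T ∧ rho T t < t} =>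
      ENNReal.ofReal ((t : ℝ) - rho T t) • Measure.dirac (t : ℝ)

/-- Nabla integrability over the interval from `c` to `d`. -/
def NablaIntegrable (T : Set ℝ) (f : ℝ → ℂ) (c d : ℝ) : Prop :=
  IntegrableOn f (Ioc c d) (nablaMeasure T)

/-- The nabla integral `∫_c^d f(t) ∇t` for points `c ≤ d` of `T`: the integral over `(c, d]`
with respect to the nabla measure. -/
def nablaIntegral (T : Set ℝ) (f : ℝ → ℂ) (c d : ℝ) : ℂ :=
  ∫ t in Ioc c d, f t ∂(nablaMeasure T)

section Hamiltonian

variable {d : ℕ}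

/-- The matrix `J = (0, -I; I, 0)`. -/
def J (d : ℕ) : Matrix (Fin d ⊕ Fin d) (Fin d ⊕ Fin d) ℂ := Matrix.fromBlocks 0 (-1) 1 0

/-- The matrix `H(t) = (-C(t), A(t)^*; A(t), B(t))`. -/
def H (A B C : ℝ → Matrix (Fin d) (Fin d) ℂ) (t : ℝ) :
    Matrix (Fin d ⊕ Fin d) (Fin d ⊕ Fin d) ℂ :=
  Matrix.fromBlocks (-C t) (A t)ᴴ (A t) (B t)

/-- The column vector `(x(t); u^ρ(t))`. -/
def shifted (T : Set ℝ) (x u : ℝ → Fin d → ℂ) (t : ℝ) : Fin d ⊕ Fin d → ℂ :=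
  Sum.elim (x t) (u (rho T t))

/-- The Hamiltonian nabla operator
`ℓ(x,u)(t) = J (x^∇(t); u^∇(t)) - H(t) (x(t); u^ρ(t))` for functions `x`, `u` given on `D ⊆ T`. -/
def hamOp (T D : Set ℝ) (A B C : ℝ → Matrix (Fin d) (Fin d) ℂ) (x u : ℝ → Fin d → ℂ) (t : ℝ) :
    Fin d ⊕ Fin d → ℂ :=
  J d *ᵥ Sum.elim (nablaDerivWithin T D x t) (nablaDerivWithin T D u t)
    - H A B C t *ᵥ shifted T x u t

/-- The function `(y^*, v^{ρ*}) ℓ(x,u) - ℓ(y,v)^* (x; u^ρ)`. -/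
def lagrangeIntegrand (T D : Set ℝ) (A B C : ℝ → Matrix (Fin d) (Fin d) ℂ)
    (x u y v : ℝ → Fin d → ℂ) (t : ℝ) : ℂ :=
  star (shifted T y v t) ⬝ᵥ hamOp T D A B C x u t
    - star (hamOp T D A B C y v t) ⬝ᵥ shifted T x u t

/-- The function `(y^*(t), v^*(t)) J (x(t); u(t))`. -/
def boundaryForm (x u y v : ℝ → Fin d → ℂ) (t : ℝ) : ℂ :=
  star (Sum.elim (y t) (v t)) ⬝ᵥ (J d *ᵥ Sum.elim (x t) (u t))

end Hamiltonian

end TimeScale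

end

/-! Since `H` is Hermitian, its two contributions to the integrand cancel, leaving `v^{ρ*} x^∇ +
v^{∇*} x - y^* u^∇ - y^{∇*} u^ρ` (`lagrangeIntegrand_eq`). By the nabla product rule this is the
nabla derivative of `W = v^* x - y^* u`, which is the boundary form. The identity is therefore the
fundamental theorem of calculus for `W`.

That theorem (`setIntegral_nablaMeasure_eq_sub`) is transferred from the real line. Extend `W`
affinely across the gaps of `T` (`interpolate`). The map `nextPoint` pushes Lebesgue measure forward
to the nabla measure (`map_nextPoint_volume`), so the nabla integral of `f` is the Lebesgue integral
of `f ∘ nextPoint`, and this composite is the derivative of the extension except at the countably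
many ends of gaps. A continuous function with an integrable derivative off a countable set is
recovered from that derivative, so integrability of the integrand is enough.

If the nabla derivatives are left-dense continuous, every factor of the reduced integrand is
essentially bounded, and the nabla measure of the interval is finite. -/

namespace TimeScale

/-! ### Backward jumps, gaps and the next point of a time scale -/

section Jump

variable {T : Set ℝ} {s t b c : ℝ}

theorem rho_le (T : Set ℝ) (t : ℝ) : rho T t ≤ t := by
  unfold rho
  split_ifs with h
  · exact csSup_le h fun s hs => hs.2.le
  · exact le_rfl

theorem le_rho (hs : s ∈ T) (hst : s < t) : s ≤ rho T t := by
  have h : (T ∩ Iio t).Nonempty := ⟨s, hs, hst⟩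
  rw [rho, if_pos h]
  exact le_csSup ⟨t, fun r hr => hr.2.le⟩ ⟨hs, hst⟩

theorem rho_mem (hT : IsClosed T) (ht : t ∈ T) : rho T t ∈ T := by
  unfold rho
  split_ifs with h
  · have := csSup_mem_closure h ⟨t, fun r hr => hr.2.le⟩
    exact hT.closure_subset_iff.2 inter_subset_left this
  · exact ht

theorem exists_mem_of_lt_rho (hc : c ∈ T) (hct : c < t) (hs : s < rho T t) :
    ∃ q ∈ T, s < q ∧ q < t := by
  have h : (T ∩ Iio t).Nonempty := ⟨c, hc, hct⟩
  rw [rho, if_pos h] at hs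
  obtain ⟨q, hq, hsq⟩ := exists_lt_of_lt_csSup h hs
  exact ⟨q, hq.1, hsq, hq.2⟩

theorem monotone_rho (T : Set ℝ) : Monotone (rho T) := by
  intro s t hst
  rcases hst.eq_or_lt with rfl | hlt
  · exact le_rfl
  by_cases hs : (T ∩ Iio s).Nonempty
  · rw [rho, if_pos hs]
    exact csSup_le hs fun r hr => le_rho hr.1 (lt_trans hr.2 hlt)
  · rw [rho, if_neg hs]
    by_cases ht : (T ∩ Iio t).Nonempty
    · obtain ⟨r, hr, hrt⟩ := ht
      have : s ≤ r := by
        by_contra h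
        exact hs ⟨r, hr, not_le.1 h⟩
      exact this.trans (le_rho hr hrt)
    · rw [rho, if_neg ht]
      exact hst

/-- The left-scattered points of `T`. -/
def leftScattered (T : Set ℝ) : Set ℝ := {t | t ∈ T ∧ rho T t < t}

theorem pairwiseDisjoint_gaps (T : Set ℝ) :
    (leftScattered T).PairwiseDisjoint fun t => Ioo (rho T t) t := by
  have key : ∀ s ∈ leftScattered T, ∀ t, s < t → Disjoint (Ioo (rho T s) s) (Ioo (rho T t) t) := by
    intro s hs t hst
    rw [Set.disjoint_left]
    intro r hr hr'
    exact absurd (hr'.1.trans hr.2) (not_lt.2 (le_rho hs.1 hst))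
  intro s hs t ht hne
  rcases lt_or_gt_of_ne hne with h | h
  · exact key s hs t h
  · exact (key t ht s h).symm

/-- The gaps to the left of these points are disjoint nonempty open sets in a separable space. -/
theorem countable_leftScattered (T : Set ℝ) : (leftScattered T).Countable :=
  (pairwiseDisjoint_gaps T).countable_of_isOpen (fun _ _ => isOpen_Ioo)
    fun _ ht => nonempty_Ioo.2 ht.2

/-- The smallest point of `T` that is at least `s`, for `s` not larger than the point `b` of `T`. -/
noncomputable def nextPoint (T : Set ℝ) (b s : ℝ) : ℝ := sInf (T ∩ Ici (min s b))

theorem nextPoint_nonempty (hb : b ∈ T) (s : ℝ) : (T ∩ Ici (min s b)).Nonempty :=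
  ⟨b, hb, mem_Ici.2 (min_le_right _ _)⟩

theorem nextPoint_mem (hT : IsClosed T) (hb : b ∈ T) (s : ℝ) : nextPoint T b s ∈ T :=
  hT.closure_subset_iff.2 inter_subset_left
    (csInf_mem_closure (nextPoint_nonempty hb s) ⟨min s b, fun _ hr => hr.2⟩)

theorem le_nextPoint (hb : b ∈ T) (hs : s ≤ b) : s ≤ nextPoint T b s :=
  le_csInf (nextPoint_nonempty hb s) fun r hr => by simpa [hs] using hr.2

theorem nextPoint_le (ht : t ∈ T) (hst : s ≤ t) : nextPoint T b s ≤ t :=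
  csInf_le ⟨min s b, fun _ hr => hr.2⟩ ⟨ht, (min_le_left _ _).trans hst⟩

theorem nextPoint_le_right (hb : b ∈ T) (s : ℝ) : nextPoint T b s ≤ b :=
  csInf_le ⟨min s b, fun _ hr => hr.2⟩ ⟨hb, mem_Ici.2 (min_le_right _ _)⟩

theorem nextPoint_eq_self (hb : b ∈ T) (hs : s ∈ T) (hsb : s ≤ b) : nextPoint T b s = s :=
  le_antisymm (nextPoint_le hs le_rfl) (le_nextPoint hb hsb)

/-- The cutoff `min s b` keeps the infimum over a nonempty set for every real `s`; monotonicity on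
the whole line then yields measurability. -/
theorem monotone_nextPoint (hb : b ∈ T) : Monotone (nextPoint T b) := fun s t hst =>
  csInf_le_csInf ⟨min s b, fun _ hr => hr.2⟩ (nextPoint_nonempty hb t)
    (inter_subset_inter_right _ (Ici_subset_Ici.2 (min_le_min_right _ hst)))

theorem nextPoint_eq (hT : IsClosed T) (hb : b ∈ T) (ht : t ∈ T) (htb : t ≤ b) (h : rho T t < s)
    (hst : s ≤ t) : nextPoint T b s = t := by
  refine le_antisymm (nextPoint_le ht hst) (not_lt.1 fun hlt => ?_)
  have h1 := le_rho (nextPoint_mem hT hb s) hlt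
  have h2 := le_nextPoint hb (hst.trans htb)
  linarith

theorem lt_nextPoint (hT : IsClosed T) (hb : b ∈ T) (hs : s ∉ T) (hsb : s ≤ b) :
    s < nextPoint T b s :=
  (le_nextPoint hb hsb).lt_of_ne fun h => hs (h ▸ nextPoint_mem hT hb s)

theorem rho_nextPoint_lt (hT : IsClosed T) (hb : b ∈ T) (hc : c ∈ T) (hcs : c ≤ s) (hs : s ∉ T)
    (hsb : s ≤ b) : rho T (nextPoint T b s) < s := by
  have hlt := lt_nextPoint hT hb hs hsb
  refine lt_of_le_of_ne (not_lt.1 fun h => ?_)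
    fun h => hs (h ▸ rho_mem hT (nextPoint_mem hT hb s))
  obtain ⟨q, hq, hsq, hqt⟩ := exists_mem_of_lt_rho hc (hcs.trans_lt hlt) h
  exact absurd (nextPoint_le hq hsq.le) (not_le.2 hqt)

theorem nextPoint_mem_leftScattered (hT : IsClosed T) (hb : b ∈ T) (hc : c ∈ T) (hcs : c ≤ s)
    (hs : s ∉ T) (hsb : s ≤ b) : nextPoint T b s ∈ leftScattered T :=
  ⟨nextPoint_mem hT hb s,
    (rho_nextPoint_lt hT hb hc hcs hs hsb).trans (lt_nextPoint hT hb hs hsb)⟩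

theorem notMem_of_mem_gap (hs : s ∈ Ioo (rho T t) t) : s ∉ T := fun h =>
  absurd (le_rho h hs.2) (not_le.2 hs.1)

/-- A point of `T` below `b` is the left end of a gap or a limit of larger points of `T`. -/
theorem right_scattered_or_dense (hT : IsClosed T) (hb : b ∈ T) (hs : s ∈ T) (hsb : s < b) :
    (∃ t ∈ leftScattered T, t ≤ b ∧ rho T t = s) ∨ ∀ η > 0, ∃ q ∈ T, s < q ∧ q < s + η := by
  by_contra! h
  obtain ⟨h1, η, hη, h2⟩ := h
  have hbη := h2 b hb hsb
  -- With no point of `T` in `(s, s + η)`, the midpoint lies in a gap, whose left end can only be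
  -- `s`.
  have hr : s + η / 2 ∉ T := fun hr => by
    have := h2 _ hr (by linarith)
    linarith
  have hrb : s + η / 2 ≤ b := by linarith
  have hL := nextPoint_mem_leftScattered hT hb hs (by linarith) hr hrb
  refine h1 _ hL (nextPoint_le_right hb _) ?_
  have hlt := rho_nextPoint_lt hT hb hs (by linarith) hr hrb
  have hle : s ≤ rho T (nextPoint T b (s + η / 2)) :=
    le_rho hs (lt_of_lt_of_le (by linarith) (le_nextPoint hb hrb))
  refine hle.antisymm' (not_lt.1 fun hlt' => ?_)
  have := h2 _ (rho_mem hT hL.1) hlt'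
  linarith

end Jump

/-! ### The nabla measure as an image of Lebesgue measure -/

section Measure

variable {T : Set ℝ} {b c : ℝ}

/-- On `(c, b]` the nabla measure is the image of Lebesgue measure under `nextPoint`. -/
theorem map_nextPoint_volume (hT : IsClosed T) (hc : c ∈ T) (hb : b ∈ T) :
    (volume.restrict (Ioc c b)).map (nextPoint T b) = (nablaMeasure T).restrict (Ioc c b) := by
  have hmeas : Measurable (nextPoint T b) := (monotone_nextPoint hb).measurable
  ext E hE
  rw [Measure.map_apply hmeas hE, Measure.restrict_apply (hmeas hE), Measure.restrict_apply hE,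
    nablaMeasure, Measure.add_apply, Measure.restrict_apply (hE.inter measurableSet_Ioc),
    Measure.sum_apply _ (hE.inter measurableSet_Ioc),
    ← measure_inter_add_sdiff _ hT.measurableSet]
  have : Countable {t : ℝ // t ∈ T ∧ rho T t < t} := (countable_leftScattered T).to_subtype
  congr 1
  -- On `T` the map is the identity, which gives the Lebesgue part.
  · congr 1
    ext s
    simp only [mem_inter_iff, mem_preimage, mem_Ioc]
    constructor
    · rintro ⟨⟨h1, h2, h3⟩, h4⟩
      rw [nextPoint_eq_self hb h4 h3] at h1
      exact ⟨⟨h1, h2, h3⟩, h4⟩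
    · rintro ⟨⟨h1, h2, h3⟩, h4⟩
      refine ⟨⟨?_, h2, h3⟩, h4⟩
      rwa [nextPoint_eq_self hb h4 h3]
  -- Off `T` the preimage of `E` consists of the whole gaps whose right ends lie in `E`; the length
  -- of a gap is the point mass at its right end.
  · have hset : (nextPoint T b ⁻¹' E ∩ Ioc c b) \ T =
        ⋃ t : {t : ℝ // t ∈ T ∧ rho T t < t},
          {s | s ∈ Ioo (rho T t) t ∧ (t : ℝ) ∈ E ∩ Ioc c b} := by
      ext s
      simp only [Set.mem_sdiff, mem_inter_iff, mem_preimage, mem_iUnion, mem_ofPred_eq]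
      constructor
      · rintro ⟨⟨h1, h2, h3⟩, h4⟩
        have hL := nextPoint_mem_leftScattered hT hb hc h2.le h4 h3
        have hlt := lt_nextPoint hT hb h4 h3
        exact ⟨⟨_, hL⟩, ⟨rho_nextPoint_lt hT hb hc h2.le h4 h3, hlt⟩, h1, h2.trans hlt,
          nextPoint_le_right hb s⟩
      · rintro ⟨⟨t, ht⟩, hs, h1, h2⟩
        refine ⟨⟨?_, (le_rho hc h2.1).trans_lt hs.1, hs.2.le.trans h2.2⟩, notMem_of_mem_gap hs⟩
        rwa [nextPoint_eq hT hb ht.1 h2.2 hs.1 hs.2.le]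
    rw [hset, measure_iUnion]
    · refine tsum_congr fun t => ?_
      rw [Measure.smul_apply, Measure.dirac_apply' _ (hE.inter measurableSet_Ioc)]
      by_cases h : (t : ℝ) ∈ E ∩ Ioc c b
      · simp only [h, and_true, ofPred_mem_eq, Real.volume_Ioo, indicator_of_mem, Pi.one_apply,
          smul_eq_mul, mul_one]
      · simp [h]
    · intro t t' hne
      exact ((pairwiseDisjoint_gaps T) t.2 t'.2 (Subtype.coe_ne_coe.2 hne)).mono
        (fun s hs => hs.1) (fun s hs => hs.1)
    · intro t
      by_cases h : (t : ℝ) ∈ E ∩ Ioc c b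
      · simp only [h, and_true, ofPred_mem_eq, measurableSet_Ioo]
      · simp [h]

theorem ae_mem_nablaMeasure (hT : IsClosed T) (hc : c ∈ T) (hb : b ∈ T) :
    ∀ᵐ t ∂(nablaMeasure T).restrict (Ioc c b), t ∈ T ∩ Ioc c b := by
  have h : ∀ᵐ t ∂(nablaMeasure T).restrict (Ioc c b), t ∈ T := by
    rw [← map_nextPoint_volume hT hc hb,
      ae_map_iff (p := (· ∈ T)) (monotone_nextPoint hb).measurable.aemeasurable hT.measurableSet]
    exact Eventually.of_forall (nextPoint_mem hT hb)
  filter_upwards [h, ae_restrict_mem measurableSet_Ioc] with t h1 h2 using ⟨h1, h2⟩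

theorem isFiniteMeasure_nablaMeasure_restrict (hT : IsClosed T) (hc : c ∈ T) (hb : b ∈ T) :
    IsFiniteMeasure ((nablaMeasure T).restrict (Ioc c b)) := by
  rw [← map_nextPoint_volume hT hc hb]
  infer_instance

end Measure

/-! ### Affine interpolation across gaps and the fundamental theorem -/

section Interpolation

variable {T : Set ℝ} {b c : ℝ} {E : Type*} [NormedAddCommGroup E] [NormedSpace ℝ E]
  {F f : ℝ → E}

/-- The extension of `F` from `T` to the reals that has slope `f t` on the gap to the left of `t`. -/
noncomputable def interpolate (T : Set ℝ) (b : ℝ) (F f : ℝ → E) (s : ℝ) : E :=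
  F (nextPoint T b s) - (nextPoint T b s - s) • f (nextPoint T b s)

theorem interpolate_of_mem (hb : b ∈ T) {s : ℝ} (hs : s ∈ T) (hsb : s ≤ b) :
    interpolate T b F f s = F s := by
  simp [interpolate, nextPoint_eq_self hb hs hsb]

theorem interpolate_of_mem_gap (hT : IsClosed T) (hb : b ∈ T) {s t : ℝ} (ht : t ∈ leftScattered T)
    (htb : t ≤ b) (hf : F t - F (rho T t) = (t - rho T t) • f t) (hs : s ∈ Icc (rho T t) t) :
    interpolate T b F f s = F t - (t - s) • f t := by
  rcases hs.1.eq_or_lt with rfl | hlt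
  · rw [interpolate_of_mem hb (rho_mem hT ht.1) (ht.2.le.trans htb), ← hf, sub_sub_cancel]
  · rw [interpolate, nextPoint_eq hT hb ht.1 htb hlt hs.2]

/-- The interpolation is a convex combination of the values at the neighbouring points of `T`. -/
theorem exists_interpolate_eq (hT : IsClosed T) (hc : c ∈ T) (hb : b ∈ T)
    (hf : ∀ t ∈ leftScattered T, c < t → t ≤ b → F t - F (rho T t) = (t - rho T t) • f t)
    {s : ℝ} (hs : s ∈ Icc c b) :
    ∃ l ∈ tsIcc T c b, ∃ r ∈ tsIcc T c b, l ≤ s ∧ s ≤ r ∧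
      (∀ q ∈ T, q ≤ s → q ≤ l) ∧ (∀ q ∈ T, s ≤ q → r ≤ q) ∧
      ∃ θ ∈ Icc (0 : ℝ) 1, s = (1 - θ) * l + θ * r ∧
        interpolate T b F f s = (1 - θ) • F l + θ • F r := by
  by_cases hsT : s ∈ T
  · refine ⟨s, ⟨hsT, hs⟩, s, ⟨hsT, hs⟩, le_rfl, le_rfl, fun _ _ h => h, fun _ _ h => h, 0,
      by simp, by simp, ?_⟩
    simp [interpolate_of_mem hb hsT hs.2]
  · have hL := nextPoint_mem_leftScattered hT hb hc hs.1 hsT hs.2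
    have hlt := lt_nextPoint hT hb hsT hs.2
    have hgt := rho_nextPoint_lt hT hb hc hs.1 hsT hs.2
    have hle := nextPoint_le_right hb s
    have hq : ∀ q ∈ T, s ≤ q → nextPoint T b s ≤ q := fun q hq hsq => nextPoint_le hq hsq
    have hI := interpolate_of_mem_gap hT hb hL hle
      (hf _ hL (hs.1.trans_lt hlt) hle) ⟨hgt.le, hlt.le⟩
    have hval := hf _ hL (hs.1.trans_lt hlt) hle
    rw [hI]
    generalize nextPoint T b s = t at *
    have hpos : 0 < t - rho T t := sub_pos.2 hL.2
    refine ⟨rho T t, ⟨rho_mem hT hL.1, le_rho hc (hs.1.trans_lt hlt), hL.2.le.trans hle⟩, t,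
      ⟨hL.1, (hs.1.trans_lt hlt).le, hle⟩, hgt.le, hlt.le,
      fun q hqT hqs => le_rho hqT (hqs.trans_lt hlt), hq,
      (s - rho T t) / (t - rho T t), ⟨by apply div_nonneg <;> linarith, ?_⟩, ?_, ?_⟩
    · rw [div_le_one hpos]
      linarith
    · field_simp
      ring
    · have h1 : F (rho T t) = F t - (t - rho T t) • f t := by rw [← hval, sub_sub_cancel]
      have h2 : (1 - (s - rho T t) / (t - rho T t)) * (t - rho T t) = t - s := by
        field_simp
        ring
      rw [h1, smul_sub, smul_smul, h2]
      module

theorem hasDerivAt_interpolate_of_notMem (hT : IsClosed T) (hc : c ∈ T) (hb : b ∈ T)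
    (hf : ∀ t ∈ leftScattered T, c < t → t ≤ b → F t - F (rho T t) = (t - rho T t) • f t)
    {s : ℝ} (hs : s ∈ Icc c b) (hsT : s ∉ T) :
    HasDerivAt (interpolate T b F f) (f (nextPoint T b s)) s := by
  have hL := nextPoint_mem_leftScattered hT hb hc hs.1 hsT hs.2
  have hlt := lt_nextPoint hT hb hsT hs.2
  have hgt := rho_nextPoint_lt hT hb hc hs.1 hsT hs.2
  have hle := nextPoint_le_right hb s
  generalize nextPoint T b s = t at *
  have hd : HasDerivAt (fun s => F t - (t - s) • f t) (f t) s := by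
    have := (((hasDerivAt_id s).const_sub t).smul_const (f t)).const_sub (F t)
    simpa using this
  refine hd.congr_of_eventuallyEq ?_
  filter_upwards [Ioo_mem_nhds hgt hlt] with r hr
  exact interpolate_of_mem_gap hT hb hL hle (hf _ hL (hs.1.trans_lt hlt) hle) ⟨hr.1.le, hr.2.le⟩

/-- The linearization error at `s` is a convex combination of the errors at the neighbours `l`, `r`
in `T`. Density on both sides of `p` keeps these neighbours within the `δ` of the derivative along
`T`. -/
theorem hasDerivAt_interpolate_of_dense (hT : IsClosed T) (hc : c ∈ T) (hb : b ∈ T)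
    (hf : ∀ t ∈ leftScattered T, c < t → t ≤ b → F t - F (rho T t) = (t - rho T t) • f t)
    {p : ℝ} (hp : p ∈ T) (hpI : p ∈ Ioo c b) (hl : ∀ η > 0, ∃ q ∈ T, p - η < q ∧ q < p)
    (hr : ∀ η > 0, ∃ q ∈ T, p < q ∧ q < p + η) {f' : E}
    (hF : HasDerivWithinAt F f' (tsIcc T c b) p) :
    HasDerivAt (interpolate T b F f) f' p := by
  rw [hasDerivAt_iff_isLittleO, Asymptotics.isLittleO_iff]
  intro ε hε
  rw [hasDerivWithinAt_iff_isLittleO, Asymptotics.isLittleO_iff] at hF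
  obtain ⟨δ, hδ, hFδ⟩ := Metric.mem_nhdsWithin_iff.1 (hF hε)
  obtain ⟨q₁, hq₁, hq₁l, hq₁p⟩ := hl δ hδ
  obtain ⟨q₂, hq₂, hq₂p, hq₂r⟩ := hr δ hδ
  have hnear : ∀ r ∈ tsIcc T c b, q₁ ≤ r → r ≤ q₂ →
      ‖F r - F p - (r - p) • f'‖ ≤ ε * |r - p| := by
    intro r hr h1 h2
    refine hFδ ⟨?_, hr⟩
    rw [Metric.mem_ball, Real.dist_eq, abs_lt]
    constructor <;> linarith
  filter_upwards [Ioo_mem_nhds hpI.1 hpI.2, Ioo_mem_nhds hq₁p hq₂p] with s hsI hsq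
  obtain ⟨l, hlD, r, hrD, hls, hsr, hlq, hrq, θ, hθ, hsθ, hsF⟩ :=
    exists_interpolate_eq (F := F) hT hc hb hf ⟨hsI.1.le, hsI.2.le⟩
  have hθ0 := hθ.1
  have hθ1 := sub_nonneg.2 hθ.2
  have hl1 := hlq q₁ hq₁ hsq.1.le
  have hr2 := hrq q₂ hq₂ hsq.2.le
  have hnl := hnear l hlD hl1 (hls.trans hsq.2.le)
  have hnr := hnear r hrD (hsq.1.le.trans hsr) hr2
  -- As `p` is itself in `T`, it does not separate `l` from `r`; both differences have the same
  -- sign, so no constant is lost.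
  have hdist : (1 - θ) * |l - p| + θ * |r - p| = |s - p| := by
    rcases le_total p s with h | h
    · have := hlq p hp h
      rw [abs_of_nonneg (by linarith), abs_of_nonneg (by linarith), abs_of_nonneg (by linarith),
        hsθ]
      ring
    · have := hrq p hp h
      rw [abs_of_nonpos (by linarith), abs_of_nonpos (by linarith), abs_of_nonpos (by linarith),
        hsθ]
      ring
  have hsplit : interpolate T b F f s - interpolate T b F f p - (s - p) • f' =
      (1 - θ) • (F l - F p - (l - p) • f') + θ • (F r - F p - (r - p) • f') := by
    rw [hsF, interpolate_of_mem hb hp hpI.2.le, hsθ]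
    module
  calc ‖interpolate T b F f s - interpolate T b F f p - (s - p) • f'‖
      ≤ (1 - θ) * (ε * |l - p|) + θ * (ε * |r - p|) := by
        rw [hsplit]
        refine (norm_add_le _ _).trans (add_le_add ?_ ?_)
        · rw [norm_smul, Real.norm_of_nonneg hθ1]
          exact mul_le_mul_of_nonneg_left hnl hθ1
        · rw [norm_smul, Real.norm_of_nonneg hθ0]
          exact mul_le_mul_of_nonneg_left hnr hθ0
    _ = ε * ‖s - p‖ := by
        rw [Real.norm_eq_abs, ← hdist]
        ring

/-- Each side of a point of `T` is treated separately: either a gap begins there and the extension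
is affine, or `T` accumulates and nearby values are convex combinations of values of `F` in a small
ball, which is convex. -/
theorem continuousOn_interpolate (hT : IsClosed T) (hc : c ∈ T) (hb : b ∈ T)
    (hf : ∀ t ∈ leftScattered T, c < t → t ≤ b → F t - F (rho T t) = (t - rho T t) • f t)
    (hF : ContinuousOn F (tsIcc T c b)) : ContinuousOn (interpolate T b F f) (Icc c b) := by
  intro p hpI
  by_cases hp : p ∉ T
  · exact (hasDerivAt_interpolate_of_notMem hT hc hb hf hpI hp).continuousAt.continuousWithinAt
  rw [not_not] at hp
  have hgap : ∀ t ∈ leftScattered T, c < t → t ≤ b →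
      ContinuousOn (interpolate T b F f) (Icc (rho T t) t) := fun t ht hct htb =>
    ContinuousOn.congr (f := fun s => F t - (t - s) • f t) (by fun_prop) fun s hs =>
      interpolate_of_mem_gap hT hb ht htb (hf t ht hct htb) hs
  have hball : ∀ ε > 0, ∃ δ > 0, ∀ l ∈ tsIcc T c b, |l - p| < δ → F l ∈ Metric.ball (F p) ε := by
    intro ε hε
    obtain ⟨δ, hδ, h⟩ := Metric.continuousOn_iff.1 hF p ⟨hp, hpI⟩ ε hε
    exact ⟨δ, hδ, fun l hl hlp => h l hl hlp⟩
  have hleft : ContinuousWithinAt (interpolate T b F f) (Icc c p) p := by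
    rcases hpI.1.eq_or_lt with rfl | hcp
    · simp
    rcases (rho_le T p).lt_or_eq with hlt | heq
    · exact (hgap p ⟨hp, hlt⟩ hcp hpI.2 p ⟨hlt.le, le_rfl⟩).mono_of_mem_nhdsWithin
        (mem_nhdsWithin.2 ⟨Ioi (rho T p), isOpen_Ioi, hlt, fun s hs => ⟨hs.1.le, hs.2.2⟩⟩)
    · rw [ContinuousWithinAt, interpolate_of_mem hb hp hpI.2,
        Metric.nhds_basis_ball.tendsto_right_iff]
      intro ε hε
      obtain ⟨δ, hδ, hδF⟩ := hball ε hε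
      obtain ⟨q, hq, hqδ, hqp⟩ :=
        exists_mem_of_lt_rho (s := p - δ) hc hcp (by rw [heq]; linarith)
      filter_upwards [inter_mem_nhdsWithin (Icc c p) (Ioi_mem_nhds hqp)] with s hs
      obtain ⟨l, hlD, r, hrD, hls, hsr, hlq, hrq, θ, hθ, -, hsF⟩ :=
        exists_interpolate_eq (F := F) hT hc hb hf ⟨hs.1.1, hs.1.2.trans hpI.2⟩
      have h1 := hlq q hq hs.2.le
      have h2 := hrq p hp hs.1.2
      rw [hsF]
      exact convex_ball _ _
        (hδF l hlD (by rw [abs_lt]; constructor <;> linarith [hs.1.2]))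
        (hδF r hrD (by rw [abs_lt]; constructor <;> linarith [hs.1.2]))
        (sub_nonneg.2 hθ.2) hθ.1 (by ring)
  have hright : ContinuousWithinAt (interpolate T b F f) (Icc p b) p := by
    rcases hpI.2.eq_or_lt with rfl | hpb
    · simp
    rcases right_scattered_or_dense hT hb hp hpb with ⟨t, ht, htb, rfl⟩ | hd
    · exact (hgap t ht (hpI.1.trans_lt ht.2) htb _ ⟨le_rfl, ht.2.le⟩).mono_of_mem_nhdsWithin
        (mem_nhdsWithin.2 ⟨Iio t, isOpen_Iio, ht.2, fun s hs => ⟨hs.2.1, hs.1.le⟩⟩)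
    · rw [ContinuousWithinAt, interpolate_of_mem hb hp hpI.2,
        Metric.nhds_basis_ball.tendsto_right_iff]
      intro ε hε
      obtain ⟨δ, hδ, hδF⟩ := hball ε hε
      obtain ⟨q, hq, hpq, hqδ⟩ := hd δ hδ
      filter_upwards [inter_mem_nhdsWithin (Icc p b) (Iio_mem_nhds hpq)] with s hs
      obtain ⟨l, hlD, r, hrD, hls, hsr, hlq, hrq, θ, hθ, -, hsF⟩ :=
        exists_interpolate_eq (F := F) hT hc hb hf ⟨hpI.1.trans hs.1.1, hs.1.2⟩
      have h1 := hlq p hp hs.1.1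
      have h2 := hrq q hq hs.2.le
      rw [hsF]
      exact convex_ball _ _
        (hδF l hlD (by rw [abs_lt]; constructor <;> linarith [hs.1.1]))
        (hδF r hrD (by rw [abs_lt]; constructor <;> linarith [hs.1.1]))
        (sub_nonneg.2 hθ.2) hθ.1 (by ring)
  rw [← Icc_union_Icc_eq_Icc hpI.1 hpI.2]
  exact hleft.union hright

/-- The fundamental theorem of calculus for the Lebesgue nabla integral. -/
theorem setIntegral_nablaMeasure_eq_sub [CompleteSpace E] (hT : IsClosed T) (hc : c ∈ T)
    (hb : b ∈ T) (hcb : c ≤ b)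
    (hf : ∀ t ∈ leftScattered T, c < t → t ≤ b → F t - F (rho T t) = (t - rho T t) • f t)
    (hF : ContinuousOn F (tsIcc T c b))
    (hd : ∀ t ∈ T, t ∈ Ioo c b → rho T t = t → HasDerivWithinAt F (f t) (tsIcc T c b) t)
    (hint : IntegrableOn f (Ioc c b) (nablaMeasure T)) :
    ∫ t in Ioc c b, f t ∂(nablaMeasure T) = F b - F c := by
  have hφ : AEMeasurable (nextPoint T b) (volume.restrict (Ioc c b)) :=
    (monotone_nextPoint hb).measurable.aemeasurable
  rw [IntegrableOn, ← map_nextPoint_volume hT hc hb] at hint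
  have hint' : IntegrableOn (fun s => f (nextPoint T b s)) (Ioc c b) :=
    (integrable_map_measure hint.aestronglyMeasurable hφ).1 hint
  rw [← map_nextPoint_volume hT hc hb, integral_map hφ hint.aestronglyMeasurable,
    ← intervalIntegral.integral_of_le hcb]
  -- Both ends of every gap are discarded, since the slope may change there. Any other point of `T`
  -- in `(c, b)` is a limit of `T` from both sides.
  have hcount : (leftScattered T ∪ rho T '' leftScattered T).Countable :=
    (countable_leftScattered T).union ((countable_leftScattered T).image _)
  rw [integral_eq_of_hasDerivAt_off_countable_of_le (interpolate T b F f) _ hcb hcount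
    (continuousOn_interpolate hT hc hb hf hF) ?_
    ((intervalIntegrable_iff_integrableOn_Ioc_of_le hcb).2 hint'),
    interpolate_of_mem hb hb le_rfl, interpolate_of_mem hb hc hcb]
  rintro p ⟨hpI, hpN⟩
  by_cases hp : p ∈ T
  · have hρ : rho T p = p := by
      by_contra h
      exact hpN (Or.inl ⟨hp, (rho_le T p).lt_of_ne h⟩)
    rw [nextPoint_eq_self hb hp hpI.2.le]
    refine hasDerivAt_interpolate_of_dense hT hc hb hf hp hpI (fun η hη => ?_) ?_
      (hd p hp hpI hρ)
    · exact exists_mem_of_lt_rho hc hpI.1 (by rw [hρ]; linarith)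
    · refine (right_scattered_or_dense hT hb hp hpI.2).resolve_left ?_
      rintro ⟨t, ht, -, htp⟩
      exact hpN (Or.inr ⟨t, ht, htp⟩)
  · exact hasDerivAt_interpolate_of_notMem hT hc hb hf ⟨hpI.1.le, hpI.2.le⟩ hp

end Interpolation

/-! ### Consequences of nabla differentiability -/

section NablaDerivative

variable {T D : Set ℝ} {E : Type*} [NormedAddCommGroup E] [NormedSpace ℝ E] {f : ℝ → E} {f' : E}
  {t : ℝ}

theorem NablaDifferentiableWithinAt.hasNablaDerivWithinAt
    (h : NablaDifferentiableWithinAt T D f t) :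
    HasNablaDerivWithinAt T D f (nablaDerivWithin T D f t) t := by
  rw [nablaDerivWithin, dif_pos h]
  exact h.choose_spec

/-- The choice `s = t` is allowed for every `ε`, so the estimate becomes an equality. -/
theorem HasNablaDerivWithinAt.sub_eq (h : HasNablaDerivWithinAt T D f f' t) (ht : t ∈ D) :
    f t - f (rho T t) = (t - rho T t) • f' := by
  have h0 : ‖f (rho T t) - f t - (rho T t - t) • f'‖ ≤ 0 := by
    refine le_of_forall_pos_le_add fun ε hε => ?_
    -- The summand 1 keeps the divisor positive when `ρ(t) = t`.
    have hpos : 0 < |rho T t - t| + 1 := by positivity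
    obtain ⟨δ, hδ, hs⟩ := h (ε / (|rho T t - t| + 1)) (by positivity)
    refine (hs t ht (by simpa using hδ)).trans ?_
    rw [zero_add, div_mul_eq_mul_div, div_le_iff₀ hpos]
    nlinarith
  have := norm_le_zero_iff.1 h0
  rw [sub_eq_zero] at this
  rw [← neg_sub, this]
  module

theorem HasNablaDerivWithinAt.hasDerivWithinAt (h : HasNablaDerivWithinAt T D f f' t)
    (ht : rho T t = t) : HasDerivWithinAt f f' D t := by
  rw [hasDerivWithinAt_iff_isLittleO, Asymptotics.isLittleO_iff]
  intro ε hε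
  obtain ⟨δ, hδ, hs⟩ := h ε hε
  refine Metric.mem_nhdsWithin_iff.2 ⟨δ, hδ, fun s hsD => ?_⟩
  have := hs s hsD.2 hsD.1
  rw [ht] at this
  rw [mem_ofPred_eq, Real.norm_eq_abs, abs_sub_comm, ← norm_neg]
  convert! this using 2
  module

theorem HasNablaDerivWithinAt.continuousWithinAt (h : HasNablaDerivWithinAt T D f f' t)
    (ht : t ∈ D) : ContinuousWithinAt f D t := by
  have hval : f (rho T t) = f t - (t - rho T t) • f' := by rw [← h.sub_eq ht, sub_sub_cancel]
  have hK : 0 < |rho T t - t| + 1 + ‖f'‖ := by positivity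
  rw [Metric.continuousWithinAt_iff]
  intro ε hε
  -- For `|s - t| < min 1 η` the increment of `f` is at most `η (|ρ(t) - t| + 1) + η ‖f'‖ = ε / 2`.
  set η := ε / 2 / (|rho T t - t| + 1 + ‖f'‖) with hη
  have hηpos : 0 < η := by positivity
  have hηK : η * (|rho T t - t| + 1 + ‖f'‖) = ε / 2 := by rw [hη]; field_simp
  obtain ⟨δ, hδ, hs⟩ := h η hηpos
  refine ⟨min δ (min 1 η), by positivity, fun {s} hsD hst => ?_⟩
  rw [Real.dist_eq, lt_min_iff, lt_min_iff] at hst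
  have h1 := hs s hsD hst.1
  have h2 : f s - f t = -(f (rho T t) - f s - (rho T t - s) • f') + (s - t) • f' := by
    rw [hval]
    module
  have h3 : |rho T t - s| ≤ |rho T t - t| + 1 := by
    refine (abs_sub_le _ t _).trans ?_
    rw [abs_sub_comm t s]
    linarith [hst.2.1]
  rw [dist_eq_norm, h2]
  calc _ ≤ η * |rho T t - s| + |s - t| * ‖f'‖ := by
        refine (norm_add_le _ _).trans (add_le_add (by rwa [norm_neg]) ?_)
        rw [norm_smul, Real.norm_eq_abs]
    _ ≤ η * (|rho T t - t| + 1) + η * ‖f'‖ := by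
        gcongr
        exact hst.2.2.le
    _ < ε := by linarith

end NablaDerivative

/-! ### Boundedness and measurability of left-dense continuous functions -/

section LeftDenseContinuous

variable {S : Set ℝ} {E : Type*} [NormedAddCommGroup E] {f : ℝ → E}

/-- At a left-dense point continuity suffices. Otherwise `S` has no points just to the left of `t`,
and to the right there is either a finite limit or again no nearby point. -/
theorem exists_bound_nhds_of_ldContinuousOn (hf : LdContinuousOn S f) {t : ℝ} (ht : t ∈ S) :
    ∃ M : ℝ, ∀ᶠ s in 𝓝[S] t, ‖f s‖ ≤ M := by
  by_cases hl : LeftDense S t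
  · refine ⟨‖f t‖ + 1, ?_⟩
    filter_upwards [((hf t ht).1 hl).norm.eventually_lt_const (lt_add_one _)] with s hs using hs.le
  have hleft : ∀ᶠ s in 𝓝[S] t, t ≤ s := by
    by_cases hne : (S ∩ Iio t).Nonempty
    · have hlt : rho S t < t := (rho_le S t).lt_of_ne fun h => hl ⟨hne, h⟩
      filter_upwards [inter_mem_nhdsWithin S (Ioi_mem_nhds hlt)] with s hs
      exact not_lt.1 fun hst => absurd (le_rho hs.1 hst) (not_le.2 hs.2)
    · filter_upwards [self_mem_nhdsWithin] with s hs
      exact not_lt.1 fun hst => hne ⟨s, hs, hst⟩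
  have hright : ∃ M : ℝ, ∀ᶠ s in 𝓝[S] t, t < s → ‖f s‖ ≤ M := by
    by_cases hr : RightDense S t
    · obtain ⟨l, hl⟩ := (hf t ht).2 hr
      refine ⟨‖l‖ + 1, ?_⟩
      have := hl.norm.eventually_lt_const (lt_add_one _)
      rw [nhdsWithin_inter', eventually_inf_principal] at this
      filter_upwards [this] with s hs hts using (hs hts).le
    · refine ⟨0, ?_⟩
      by_cases hne : (S ∩ Ioi t).Nonempty
      · have hle : t ≤ sigma S t := by
          rw [sigma, if_pos hne]
          exact le_csInf hne fun r hr => hr.2.le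
        have hlt : t < sigma S t := hle.lt_of_ne fun h => hr ⟨hne, h.symm⟩
        filter_upwards [inter_mem_nhdsWithin S (Iio_mem_nhds hlt)] with s hs hts
        refine absurd (mem_Iio.1 hs.2) (not_lt.2 ?_)
        rw [sigma, if_pos hne]
        exact csInf_le ⟨t, fun r hr => hr.2.le⟩ ⟨hs.1, hts⟩
      · filter_upwards [self_mem_nhdsWithin] with s hs hts
        exact absurd ⟨s, hs, hts⟩ hne
  obtain ⟨M, hM⟩ := hright
  refine ⟨max M ‖f t‖, ?_⟩
  filter_upwards [hleft, hM] with s h1 h2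
  rcases h1.eq_or_lt with rfl | h
  · exact le_max_right _ _
  · exact (h2 h).trans (le_max_left _ _)

theorem exists_bound_of_ldContinuousOn (hS : IsCompact S) (hf : LdContinuousOn S f) :
    ∃ M : ℝ, ∀ s ∈ S, ‖f s‖ ≤ M := by
  refine hS.induction_on (p := fun U => ∃ M : ℝ, ∀ s ∈ U, ‖f s‖ ≤ M) ⟨0, by simp⟩
    (fun U V hUV ⟨M, hM⟩ => ⟨M, fun s hs => hM s (hUV hs)⟩) ?_ fun t ht => ?_
  · rintro U V ⟨M, hM⟩ ⟨N, hN⟩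
    refine ⟨max M N, fun s hs => ?_⟩
    rcases hs with hs | hs
    · exact (hM s hs).trans (le_max_left _ _)
    · exact (hN s hs).trans (le_max_right _ _)
  · obtain ⟨M, hM⟩ := exists_bound_nhds_of_ldContinuousOn hf ht
    exact ⟨_, hM, M, fun s hs => hs⟩

theorem countable_not_leftDense (S : Set ℝ) : {t | t ∈ S ∧ ¬ LeftDense S t}.Countable := by
  have hmin : {t | t ∈ S ∧ ¬ (S ∩ Iio t).Nonempty}.Subsingleton := by
    intro s hs t ht
    by_contra hne
    rcases lt_or_gt_of_ne hne with h | h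
    · exact ht.2 ⟨s, hs.1, h⟩
    · exact hs.2 ⟨t, ht.1, h⟩
  refine ((countable_leftScattered S).union hmin.countable).mono fun t ht => ?_
  by_cases hne : (S ∩ Iio t).Nonempty
  · exact Or.inl ⟨ht.1, (rho_le S t).lt_of_ne fun h => ht.2 ⟨hne, h⟩⟩
  · exact Or.inr ⟨ht.1, hne⟩

/-- Only countably many points of `S` fail to be left-dense; on the remaining ones `f` is
continuous, and on a countable set measurability is automatic. -/
theorem aestronglyMeasurable_of_ldContinuousOn (hS : IsClosed S) (hf : LdContinuousOn S f)
    (μ : Measure ℝ) : AEStronglyMeasurable f (μ.restrict S) := by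
  set N := {t | t ∈ S ∧ ¬ LeftDense S t} with hN
  have hNc : N.Countable := countable_not_leftDense S
  have h1 : AEStronglyMeasurable f (μ.restrict N) := by
    have : Countable N := hNc.to_subtype
    rw [← biUnion_of_singleton N, biUnion_eq_iUnion, aestronglyMeasurable_iUnion_iff]
    exact fun t => (continuousOn_singleton f t).aestronglyMeasurable (measurableSet_singleton _)
  have h2 : AEStronglyMeasurable f (μ.restrict (S \ N)) := by
    refine ContinuousOn.aestronglyMeasurable (fun t ht => ?_)
      (hS.measurableSet.diff hNc.measurableSet)
    refine ContinuousWithinAt.mono ?_ (sdiff_subset (t := N))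
    exact (hf t ht.1).1 (not_not.1 fun h => ht.2 ⟨ht.1, h⟩)
  have h3 := aestronglyMeasurable_union_iff.2 ⟨h1, h2⟩
  rwa [union_sdiff_self, union_eq_self_of_subset_left fun t ht => ht.1] at h3

end LeftDenseContinuous

/-! ### Essential boundedness -/

section Bounded

variable {S : Set ℝ} {E : Type*} [NormedAddCommGroup E] {f : ℝ → E} {μ : Measure ℝ}

theorem memLp_top_of_ldContinuousOn (hS : IsCompact S) (hμ : ∀ᵐ t ∂μ, t ∈ S)
    (hf : LdContinuousOn S f) : MemLp f ⊤ μ := by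
  obtain ⟨M, hM⟩ := exists_bound_of_ldContinuousOn hS hf
  have h := aestronglyMeasurable_of_ldContinuousOn hS.isClosed hf μ
  rw [Measure.restrict_eq_self_of_ae_mem hμ] at h
  exact memLp_top_of_bound h M (hμ.mono hM)

/-- A function that is continuous on a compact set is essentially bounded along a measurable map
into that set. -/
theorem memLp_top_comp_of_continuousOn (hS : IsCompact S) (hf : ContinuousOn f S) {g : ℝ → ℝ}
    (hg : Measurable g) (hμ : ∀ᵐ t ∂μ, g t ∈ S) : MemLp (fun t => f (g t)) ⊤ μ := by
  obtain ⟨M, hM⟩ := hS.exists_bound_of_continuousOn hf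
  refine memLp_top_of_bound ?_ M (hμ.mono fun t ht => hM _ ht)
  have h : AEStronglyMeasurable f (μ.map g) := by
    rw [← Measure.restrict_eq_self_of_ae_mem (μ := μ.map g) (s := S)]
    · exact hf.aestronglyMeasurable hS.measurableSet
    · exact (ae_map_iff (p := (· ∈ S)) hg.aemeasurable hS.measurableSet).2 hμ
  exact h.comp_measurable hg

end Bounded

/-! ### Algebra of the Hamiltonian system -/

section Hamiltonian

variable {d : ℕ} {T D : Set ℝ} {A B C : ℝ → Matrix (Fin d) (Fin d) ℂ} {x u y v : ℝ → Fin d → ℂ}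
  {t : ℝ}

theorem J_mulVec (p q : Fin d → ℂ) : J d *ᵥ Sum.elim p q = Sum.elim (-q) p := by
  simp [J, Matrix.fromBlocks_mulVec, Matrix.neg_mulVec]

theorem star_sumElim (p q : Fin d → ℂ) : star (Sum.elim p q) = Sum.elim (star p) (star q) := by
  ext i
  cases i <;> rfl

theorem boundaryForm_eq (x u y v : ℝ → Fin d → ℂ) (t : ℝ) :
    boundaryForm x u y v t = ∑ i, (star (v t i) * x t i - star (y t i) * u t i) := by
  rw [boundaryForm, J_mulVec, star_sumElim, sumElim_dotProduct_sumElim]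
  simp only [dotProduct, Pi.star_apply, Pi.neg_apply, ← Finset.sum_add_distrib]
  exact Finset.sum_congr rfl fun i _ => by ring

theorem isHermitian_H (hB : (B t).IsHermitian) (hC : (C t).IsHermitian) :
    (H A B C t).IsHermitian := by
  refine Matrix.IsHermitian.fromBlocks hC.neg (Matrix.conjTranspose_conjTranspose _) hB

/-- The coefficients drop out of the integrand of the Lagrange identity. -/
theorem lagrangeIntegrand_eq (hB : (B t).IsHermitian) (hC : (C t).IsHermitian) :
    lagrangeIntegrand T D A B C x u y v t =
      ∑ i, (star (v (rho T t) i) * nablaDerivWithin T D x t i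
        + star (nablaDerivWithin T D v t i) * x t i
        - star (y t i) * nablaDerivWithin T D u t i
        - star (nablaDerivWithin T D y t i) * u (rho T t) i) := by
  have hH : star (H A B C t *ᵥ shifted T y v t) ⬝ᵥ shifted T x u t =
      star (shifted T y v t) ⬝ᵥ (H A B C t *ᵥ shifted T x u t) := by
    rw [Matrix.star_mulVec, (isHermitian_H hB hC).eq, Matrix.dotProduct_mulVec]
  rw [lagrangeIntegrand, hamOp, hamOp, dotProduct_sub, star_sub, sub_dotProduct, hH, J_mulVec,
    J_mulVec, sub_sub_sub_cancel_right, shifted, shifted, star_sumElim, star_sumElim,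
    sumElim_dotProduct_sumElim, sumElim_dotProduct_sumElim]
  simp only [dotProduct, Pi.star_apply, Pi.neg_apply, ← Finset.sum_add_distrib,
    ← Finset.sum_sub_distrib, star_neg]
  exact Finset.sum_congr rfl fun i _ => by ring

end Hamiltonian

/-! ### The Lagrange identity -/

section Lagrange

variable {d : ℕ} {T : Set ℝ} {a b : ℝ} {x u y v : ℝ → Fin d → ℂ}

theorem isCompact_tsIcc (hT : IsClosed T) (p q : ℝ) : IsCompact (tsIcc T p q) :=
  isCompact_Icc.inter_left hT

theorem mem_tsIcc_of_rho_lt {t : ℝ} (ht : t ∈ T) (h : rho T a < t) (htb : t ≤ b) :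
    t ∈ tsIcc T a b :=
  ⟨ht, not_lt.1 fun hta => absurd (le_rho ht hta) (not_le.2 h), htb⟩

theorem tsIcc_subset_tsIcc_rho (T : Set ℝ) (a b : ℝ) :
    tsIcc T a b ⊆ tsIcc T (rho T a) b := fun _ ht =>
  ⟨ht.1, (rho_le T a).trans ht.2.1, ht.2.2⟩

/-- The delicate point is `ρ(a)`, where differentiability is not assumed if `ρ(a) < a`; it is then
isolated in the domain. -/
theorem continuousOn_of_nablaDifferentiable {E : Type*} [NormedAddCommGroup E] [NormedSpace ℝ E]
    {f : ℝ → E} (ha : a ∈ T) (hab : a ≤ b)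
    (hf : ∀ t ∈ tsIcc T a b, NablaDifferentiableWithinAt T (tsIcc T (rho T a) b) f t) :
    ContinuousOn f (tsIcc T (rho T a) b) := by
  intro t ht
  rcases ht.2.1.eq_or_lt with rfl | hlt
  · rcases (rho_le T a).lt_or_eq with h | h
    · have : ContinuousWithinAt f {rho T a} (rho T a) := continuousWithinAt_singleton
      refine this.mono_of_mem_nhdsWithin (mem_nhdsWithin.2 ⟨Iio a, isOpen_Iio, h, fun s hs => ?_⟩)
      exact le_antisymm (le_rho hs.2.1 hs.1) hs.2.2.1
    · have hmem : rho T a ∈ tsIcc T a b := by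
        rw [h]
        exact ⟨ha, le_rfl, hab⟩
      exact (hf _ hmem).hasNablaDerivWithinAt.continuousWithinAt ht
  · exact (hf t (mem_tsIcc_of_rho_lt ht.1 hlt ht.2.2)).hasNablaDerivWithinAt.continuousWithinAt ht

end Lagrange

end TimeScale

theorem mainTheorem9 {d : ℕ} (T : Set ℝ) (hT : TimeScale.IsTimeScale T) (a b : ℝ)
    (ha : a ∈ T) (hb : b ∈ T) (hab : a ≤ b)
    (A B C : ℝ → Matrix (Fin d) (Fin d) ℂ)
    (hB : ∀ t ∈ TimeScale.tsIcc T a b, (B t).IsHermitian)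
    (hC : ∀ t ∈ TimeScale.tsIcc T a b, (C t).IsHermitian)
    (D : Set ℝ) (hD : D = TimeScale.tsIcc T (TimeScale.rho T a) b)
    (x u y v : ℝ → Fin d → ℂ)
    (hx : ∀ t ∈ TimeScale.tsIcc T a b, TimeScale.NablaDifferentiableWithinAt T D x t)
    (hu : ∀ t ∈ TimeScale.tsIcc T a b, TimeScale.NablaDifferentiableWithinAt T D u t)
    (hy : ∀ t ∈ TimeScale.tsIcc T a b, TimeScale.NablaDifferentiableWithinAt T D y t)
    (hv : ∀ t ∈ TimeScale.tsIcc T a b, TimeScale.NablaDifferentiableWithinAt T D v t) :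
    -- the identity holds whenever the integral on its left-hand side exists
    (TimeScale.NablaIntegrable T (TimeScale.lagrangeIntegrand T D A B C x u y v)
        (TimeScale.rho T a) b →
      TimeScale.nablaIntegral T (TimeScale.lagrangeIntegrand T D A B C x u y v)
          (TimeScale.rho T a) b =
        TimeScale.boundaryForm x u y v b -
          TimeScale.boundaryForm x u y v (TimeScale.rho T a)) ∧
    -- and the integral exists if the nabla derivatives are left-dense continuous
    (TimeScale.LdContinuousOn (TimeScale.tsIcc T a b) (TimeScale.nablaDerivWithin T D x) →
      TimeScale.LdContinuousOn (TimeScale.tsIcc T a b) (TimeScale.nablaDerivWithin T D u) →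
      TimeScale.LdContinuousOn (TimeScale.tsIcc T a b) (TimeScale.nablaDerivWithin T D y) →
      TimeScale.LdContinuousOn (TimeScale.tsIcc T a b) (TimeScale.nablaDerivWithin T D v) →
      TimeScale.NablaIntegrable T (TimeScale.lagrangeIntegrand T D A B C x u y v)
        (TimeScale.rho T a) b) := by
  open TimeScale in
  subst hD
  have hTc := hT.2
  have hc : rho T a ∈ T := rho_mem hTc ha
  have hcb : rho T a ≤ b := (rho_le T a).trans hab
  have hcx := continuousOn_of_nablaDifferentiable ha hab hx
  have hcu := continuousOn_of_nablaDifferentiable ha hab hu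
  have hcy := continuousOn_of_nablaDifferentiable ha hab hy
  have hcv := continuousOn_of_nablaDifferentiable ha hab hv
  constructor
  · refine setIntegral_nablaMeasure_eq_sub hTc hc hb hcb (fun t ht hct htb => ?_) ?_
      (fun t ht hct hρ => ?_)
    · have htI := mem_tsIcc_of_rho_lt ht.1 hct htb
      have htD := tsIcc_subset_tsIcc_rho T a b htI
      rw [lagrangeIntegrand_eq (hB t htI) (hC t htI), boundaryForm_eq, boundaryForm_eq,
        ← Finset.sum_sub_distrib, Finset.smul_sum]
      refine Finset.sum_congr rfl fun i _ => ?_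
      have ex := congrFun ((hx t htI).hasNablaDerivWithinAt.sub_eq htD) i
      have eu := congrFun ((hu t htI).hasNablaDerivWithinAt.sub_eq htD) i
      have ey := congrArg star (congrFun ((hy t htI).hasNablaDerivWithinAt.sub_eq htD) i)
      have ev := congrArg star (congrFun ((hv t htI).hasNablaDerivWithinAt.sub_eq htD) i)
      -- Discrete product rule across a gap: in `v^* x` the first factor is frozen at `ρ(t)` and the
      -- second at `t`; in `y^* u` the roles are exchanged.
      simp only [Pi.sub_apply, Pi.smul_apply, Complex.real_smul, star_sub, star_mul',
        Complex.star_def, Complex.conj_ofReal] at ex eu ey ev ⊢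
      linear_combination (starRingEnd ℂ) (v (rho T t) i) * ex + x t i * ev
        - (starRingEnd ℂ) (y t i) * eu - u (rho T t) i * ey
    · refine ContinuousOn.congr (f := fun t => ∑ i, (star (v t i) * x t i - star (y t i) * u t i))
        ?_ fun t _ => boundaryForm_eq x u y v t
      fun_prop
    · have htI := mem_tsIcc_of_rho_lt ht hct.1 hct.2.le
      have dx := hasDerivWithinAt_pi.1 ((hx t htI).hasNablaDerivWithinAt.hasDerivWithinAt hρ)
      have du := hasDerivWithinAt_pi.1 ((hu t htI).hasNablaDerivWithinAt.hasDerivWithinAt hρ)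
      have dy := hasDerivWithinAt_pi.1 ((hy t htI).hasNablaDerivWithinAt.hasDerivWithinAt hρ)
      have dv := hasDerivWithinAt_pi.1 ((hv t htI).hasNablaDerivWithinAt.hasDerivWithinAt hρ)
      -- Where `ρ(t) = t` the shifts disappear and the ordinary product rule applies.
      rw [lagrangeIntegrand_eq (hB t htI) (hC t htI), hρ,
        show boundaryForm x u y v = _ from funext (boundaryForm_eq x u y v)]
      refine HasDerivWithinAt.fun_sum fun i _ => ?_
      convert! ((dv i).star.mul (dx i)).sub ((dy i).star.mul (du i)) using 1
      ring
  · intro lx lu ly lv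
    have := isFiniteMeasure_nablaMeasure_restrict hTc hc hb
    have hae := ae_mem_nablaMeasure hTc hc hb
    have hS : ∀ᵐ t ∂(nablaMeasure T).restrict (Ioc (rho T a) b), t ∈ tsIcc T a b := by
      filter_upwards [hae] with t ht using mem_tsIcc_of_rho_lt ht.1 ht.2.1 ht.2.2
    have hDm : ∀ᵐ t ∂(nablaMeasure T).restrict (Ioc (rho T a) b), t ∈ tsIcc T (rho T a) b := by
      filter_upwards [hS] with t ht using tsIcc_subset_tsIcc_rho T a b ht
    have hDρ : ∀ᵐ t ∂(nablaMeasure T).restrict (Ioc (rho T a) b),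
        rho T t ∈ tsIcc T (rho T a) b := by
      filter_upwards [hae] with t ht using
        ⟨rho_mem hTc ht.1, le_rho hc ht.2.1, (rho_le T t).trans ht.2.2⟩
    have hcS := isCompact_tsIcc hTc a b
    have hcD := isCompact_tsIcc hTc (rho T a) b
    have hρm := (monotone_rho T).measurable
    have mx' := (memLp_top_of_ldContinuousOn hcS hS lx).eval
    have mu' := (memLp_top_of_ldContinuousOn hcS hS lu).eval
    have my' := (memLp_top_of_ldContinuousOn hcS hS ly).eval
    have mv' := (memLp_top_of_ldContinuousOn hcS hS lv).eval
    -- In the reduced integrand `x` and `y` occur at `t`, but `u` and `v` at `ρ(t)`.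
    have mx := (memLp_top_comp_of_continuousOn hcD hcx measurable_id hDm).eval
    have my := (memLp_top_comp_of_continuousOn hcD hcy measurable_id hDm).eval
    have mu := (memLp_top_comp_of_continuousOn hcD hcu hρm hDρ).eval
    have mv := (memLp_top_comp_of_continuousOn hcD hcv hρm hDρ).eval
    have hsum := memLp_finsetSum Finset.univ fun i _ =>
      ((((mx' i).mul' (r := ⊤) (mv i).star).add ((mx i).mul' (r := ⊤) (mv' i).star)).sub
        ((mu' i).mul' (r := ⊤) (my i).star)).sub ((mu i).mul' (r := ⊤) (my' i).star)
    refine (hsum.integrable le_top).congr ?_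
    filter_upwards [hS] with t ht
    rw [lagrangeIntegrand_eq (hB t ht) (hC t ht)]
    rfl
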